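/- Let $n\in\mathbb N$ and let $I=\{t\in\mathbb Z: a\le t\le b\}$, where $a$ is an integer or $-\infty$, $b$ is an integer or $+\infty$, and $b-a\ge 1$; put $b+1=+\infty$ if $b=+\infty$. For a sequence $y=\{y(t)\}_{t=a}^{b+1}\subset\mathbb C^{2n}$ write $y(t)=(u(t)^T,v(t)^T)^T$ with $u(t),v(t)\in\mathbb C^n$, and put $\Delta y(t)=y(t+1)-y(t)$ and $R(y)(t)=(u(t+1)^T,v(t)^T)^T$ for $t\in I$. Let $J=\begin{pmatrix}0&-I_n\\ I_n&0\end{pmatrix}$. For $t\in I$ let $W(t)=\operatorname{diag}(W_1(t),W_2(t))$ with positive semidefinite Hermitian $n\times n$ matrices $W_1(t),W_2(t)$, and let $$P(t)=\begin{pmatrix}-C(t)&D(t)\\ A(t)&B(t)\end{pmatrix}$$ with complex $n\times n$ matrices $A(t),B(t),C(t),D(t)$. Define, for $t\in I$, $$(\mathscr L_1y)(t)=J\Delta y(t)-P(t)R(y)(t),\qquad (\mathscr L_2y)(t)=J\Delta y(t)-P(t)^*R(y)(t).$$ Let $l^2_W(I)$ be the space of all sequences $y$ as above with $\sum_{t\in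 I}R(y)(t)^*W(t)R(y)(t)<\infty$, with the semi-inner product $\langle y,z\rangle=\sum_{t\in I}R(z)(t)^*W(t)R(y)(t)$, and let $L^2_W(I)$ be the Hilbert space obtained as the quotient of $l^2_W(I)$ by $\{y:\langle y,y\rangle=0\}$, with classes denoted by $[y]$. For $i=1,2$ define linear relations (linear subspaces) in $L^2_W(I)\times L^2_W(I)$: the maximal relation $H_i$ is the set of all pairs $([y],[g])$ such that some representative $y\in[y]$ satisfies $(\mathscr L_iy)(t)=W(t)R(g)(t)$ for all $t\in I$; the pre-minimal relation $H_{i,00}$ is the set of all such pairs for which the representative $y$ can be chosen so that in addition there are $s,k\in I$ with $y(t)=0$ for $t\le s$ and for $t\ge k+1$; the minimal relation is the closure $H_{i,0}=\overline{H_{i,00}}$. For a linear relation $T$ in a Hilbert space $X$, put $T^*=\{(y,g)\in X\times X:\langle y,f\rangle=\langle g,x\rangle\ \text{for all }(x,f)\in T\}$. Two closed linear relations $T,S$ in $X$ form a dual pair $\{T,S\}$ if $\langle f,y\rangle=\langle x,g\rangle$ for all $(x,f)\in T$ and $(y,g)\in S$. **Theorem.** Assume that $I_n-A(t)$ and $I_n-D(t)$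 are invertible for every $t\in I$. Then $$H_2=H_{1,0}^*\qquad\text{and}\qquad H_1=H_{2,0}^*,$$ and consequently $\{H_{1,0},H_{2,0}\}$ is a dual pair. -/

import Mathlib

namespace DiscreteHamiltonian

open scoped Matrix ComplexOrder

/-- A (finite or infinite) integer interval `{t : ℤ | a ≤ t ≤ b}`, where `a` is an integer or `-∞`,
`b` is an integer or `+∞`, and `b - a ≥ 1`. -/
structure IntInterval where
  a : WithBot ℤ
  b : WithTop ℤ
  one_le_length : ∀ a₀ b₀ : ℤ, a = (a₀ : WithBot ℤ) → b = (b₀ : WithTop ℤ) → 1 ≤ b₀ - a₀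

namespace IntInterval

variable (I : IntInterval)

/-- The points of the interval `{t}_{t=a}^{b}`. -/
def Pt : Type := {t : ℤ // I.a ≤ (t : WithBot ℤ) ∧ (t : WithTop ℤ) ≤ I.b}

/-- The points of the extended interval `{t}_{t=a}^{b+1}`, where `b + 1 = +∞` if `b = +∞`. -/
def ExtPt : Type := {t : ℤ // I.a ≤ (t : WithBot ℤ) ∧ (t : WithTop ℤ) ≤ I.b + 1}

variable {I}

/-- The point `t` of the interval as a point of the extended interval. -/
def Pt.toExt (t : I.Pt) : I.ExtPt :=
  ⟨t.1, t.2.1, t.2.2.trans (by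
    cases h : I.b with
    | top => exact le_top
    | coe b => exact_mod_cast (Int.le_add_one le_rfl))⟩

/-- The point `t + 1` of the extended interval. -/
def Pt.next (t : I.Pt) : I.ExtPt :=
  ⟨t.1 + 1, t.2.1.trans (by exact_mod_cast (Int.le_add_one le_rfl)), by
    rw [WithTop.coe_add]
    exact add_le_add t.2.2 le_rfl⟩

theorem nonempty_pt (I : IntInterval) : Nonempty I.Pt := by
  obtain ⟨a, b, h⟩ := I
  induction a using WithBot.recBotCoe with
  | bot =>
    induction b using WithTop.recTopCoe with
    | top => exact ⟨⟨0, bot_le, le_top⟩⟩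
    | coe b => exact ⟨⟨b, bot_le, le_rfl⟩⟩
  | coe a =>
    induction b using WithTop.recTopCoe with
    | top => exact ⟨⟨a, le_rfl, le_top⟩⟩
    | coe b =>
      have h1 := h a b rfl rfl
      exact ⟨⟨a, le_rfl, WithTop.coe_le_coe.2 (by omega)⟩⟩

end IntInterval

/-- Vectors `(uᵀ, vᵀ)ᵀ` of `ℂ²ⁿ`; the `inl` coordinates are `u`, the `inr` coordinates are `v`. -/
abbrev Vec (n : ℕ) : Type := Fin n ⊕ Fin n → ℂ

/-- `2n × 2n` complex matrices, in `n × n` blocks. -/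
abbrev Mat (n : ℕ) : Type := Matrix (Fin n ⊕ Fin n) (Fin n ⊕ Fin n) ℂ

/-- The space `l(I)` of all sequences `{y(t)}_{t=a}^{b+1}` in `ℂ²ⁿ`. -/
abbrev Seq (I : IntInterval) (n : ℕ) : Type := I.ExtPt → Vec n

variable {I : IntInterval} {n : ℕ}

/-- The partial right shift `R(y)(t) = (u(t+1)ᵀ, v(t)ᵀ)ᵀ`. -/
def shift (y : Seq I n) (t : I.Pt) : Vec n :=
  Sum.elim (fun j => y t.next (Sum.inl j)) (fun j => y t.toExt (Sum.inr j))

/-- The expression `J Δy(t) - P(t) R(y)(t)`; here `Matrix.J` is `[[0, -Iₙ], [Iₙ, 0]]`. -/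
noncomputable def hamExpr (P : I.Pt → Mat n) (y : Seq I n) (t : I.Pt) : Vec n :=
  Matrix.J (Fin n) ℂ *ᵥ (y t.next - y t.toExt) - P t *ᵥ shift y t

theorem shift_add (x y : Seq I n) (t : I.Pt) : shift (x + y) t = shift x t + shift y t := by
  ext (j | j) <;> rfl

theorem shift_smul (c : ℂ) (y : Seq I n) (t : I.Pt) : shift (c • y) t = c • shift y t := by
  ext (j | j) <;> rfl

theorem shift_zero (t : I.Pt) : shift (0 : Seq I n) t = 0 := by
  ext (j | j) <;> rfl

theorem hamExpr_add (P : I.Pt → Mat n) (x y : Seq I n) (t : I.Pt) :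
    hamExpr P (x + y) t = hamExpr P x t + hamExpr P y t := by
  simp only [hamExpr, shift_add, Pi.add_apply, add_sub_add_comm, Matrix.mulVec_add]

theorem hamExpr_smul (P : I.Pt → Mat n) (c : ℂ) (y : Seq I n) (t : I.Pt) :
    hamExpr P (c • y) t = c • hamExpr P y t := by
  simp only [hamExpr, shift_smul, Pi.smul_apply, ← smul_sub, Matrix.mulVec_smul]

theorem hamExpr_zero (P : I.Pt → Mat n) (t : I.Pt) : hamExpr P (0 : Seq I n) t = 0 := by
  simp [hamExpr, shift_zero]

/-- A weight function `W(t) = diag(W₁(t), W₂(t))` on the interval, with positive semidefinite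
Hermitian `n × n` blocks. -/
structure Weight (I : IntInterval) (n : ℕ) where
  W₁ : I.Pt → Matrix (Fin n) (Fin n) ℂ
  W₂ : I.Pt → Matrix (Fin n) (Fin n) ℂ
  posSemidef₁ : ∀ t, (W₁ t).PosSemidef
  posSemidef₂ : ∀ t, (W₂ t).PosSemidef

namespace Weight

variable (w : Weight I n)

/-- The `2n × 2n` matrix `W(t) = diag(W₁(t), W₂(t))`. -/
def mat (t : I.Pt) : Mat n := Matrix.fromBlocks (w.W₁ t) 0 0 (w.W₂ t)

/-- The summand `R(x)*(t) W(t) R(y)(t)`. -/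
noncomputable def form (x y : Seq I n) (t : I.Pt) : ℂ :=
  star (shift x t) ⬝ᵥ (w.mat t *ᵥ shift y t)

theorem exists_factor (t : I.Pt) : ∃ B : Mat n, w.mat t = Bᴴ * B := by
  have key : ∀ M : Matrix (Fin n) (Fin n) ℂ, M.PosSemidef → ∃ B, M = Bᴴ * B := by
    intro M hM
    open scoped MatrixOrder in
    exact CStarAlgebra.nonneg_iff_eq_star_mul_self.mp hM.nonneg
  obtain ⟨B₁, h₁⟩ := key _ (w.posSemidef₁ t)
  obtain ⟨B₂, h₂⟩ := key _ (w.posSemidef₂ t)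
  refine ⟨Matrix.fromBlocks B₁ 0 0 B₂, ?_⟩
  simp [mat, Matrix.fromBlocks_conjTranspose, Matrix.fromBlocks_multiply, h₁, h₂]

/-- A factor `B(t)` with `B(t)* B(t) = W(t)`. -/
noncomputable def factor (t : I.Pt) : Mat n := (w.exists_factor t).choose

/-- The vector `B(t) R(y)(t)` with the Euclidean norm. -/
noncomputable def rep (y : Seq I n) (t : I.Pt) : EuclideanSpace ℂ (Fin n ⊕ Fin n) :=
  WithLp.toLp 2 (w.factor t *ᵥ shift y t)

theorem form_eq_inner (x y : Seq I n) (t : I.Pt) :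
    w.form x y t = inner ℂ (w.rep x t) (w.rep y t) := by
  have h : w.mat t = (w.factor t)ᴴ * w.factor t := (w.exists_factor t).choose_spec
  rw [rep, rep, EuclideanSpace.inner_toLp_toLp, form, h, ← Matrix.mulVec_mulVec,
    Matrix.dotProduct_mulVec, Matrix.star_mulVec, dotProduct_comm]

theorem form_self_re (y : Seq I n) (t : I.Pt) : (w.form y y t).re = ‖w.rep y t‖ ^ 2 := by
  rw [form_eq_inner, inner_self_eq_norm_sq_to_K]
  norm_cast

theorem rep_add (x y : Seq I n) (t : I.Pt) : w.rep (x + y) t = w.rep x t + w.rep y t := by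
  simp [rep, shift_add, Matrix.mulVec_add]

theorem rep_smul (c : ℂ) (y : Seq I n) (t : I.Pt) : w.rep (c • y) t = c • w.rep y t := by
  simp [rep, shift_smul, Matrix.mulVec_smul]

theorem rep_zero (t : I.Pt) : w.rep (0 : Seq I n) t = 0 := by
  simp [rep, shift_zero]

/-- `y` is square summable with weight `W`: the series `∑_{t ∈ I} R(y)*(t) W(t) R(y)(t)` of
nonnegative numbers converges. -/
def IsSqSummable (y : Seq I n) : Prop := Summable fun t => (w.form y y t).re

theorem isSqSummable_iff (y : Seq I n) : w.IsSqSummable y ↔ Memℓp (w.rep y) 2 := by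
  rw [memℓp_gen_iff (by norm_num), IsSqSummable]
  simp [form_self_re]

/-- The sequences that are square summable with weight `W`, as a subspace of `l(I)`. -/
def sqSummable : Submodule ℂ (Seq I n) where
  carrier := {y | w.IsSqSummable y}
  zero_mem' := by
    change w.IsSqSummable 0
    rw [isSqSummable_iff, show w.rep (0 : Seq I n) = 0 from funext w.rep_zero]
    exact zero_memℓp
  add_mem' {x y} hx hy := by
    change w.IsSqSummable _
    rw [isSqSummable_iff, show w.rep (x + y) = w.rep x + w.rep y from funext (w.rep_add x y)]
    exact ((w.isSqSummable_iff x).1 hx).add ((w.isSqSummable_iff y).1 hy)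
  smul_mem' c y hy := by
    change w.IsSqSummable _
    rw [isSqSummable_iff, show w.rep (c • y) = c • w.rep y from funext (w.rep_smul c y)]
    exact ((w.isSqSummable_iff y).1 hy).const_smul c

/-- The semi-inner product space `l²_W(I)`. -/
def SemiL2 : Type := ↥w.sqSummable

namespace SemiL2

variable {w}

noncomputable instance : AddCommGroup w.SemiL2 := inferInstanceAs (AddCommGroup ↥w.sqSummable)

noncomputable instance : Module ℂ w.SemiL2 := inferInstanceAs (Module ℂ ↥w.sqSummable)

/-- The sequence underlying an element of `l²_W(I)`. -/
def seq (y : w.SemiL2) : Seq I n := y.1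

theorem seq_add (x y : w.SemiL2) : (x + y).seq = x.seq + y.seq := rfl

theorem seq_smul (c : ℂ) (y : w.SemiL2) : (c • y).seq = c • y.seq := rfl

theorem seq_zero : (0 : w.SemiL2).seq = 0 := rfl

/-- The image of `y` in the Hilbert sum of copies of `ℂ²ⁿ`. -/
noncomputable def toLp (y : w.SemiL2) : lp (fun _ : I.Pt => EuclideanSpace ℂ (Fin n ⊕ Fin n)) 2 :=
  ⟨w.rep y.seq, (w.isSqSummable_iff y.seq).1 y.2⟩

theorem toLp_sub (x y : w.SemiL2) : toLp (x - y) = toLp x - toLp y := by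
  rw [eq_sub_iff_add_eq]
  ext1
  funext t
  change w.rep (x - y).seq t + w.rep y.seq t = w.rep x.seq t
  rw [← rep_add, ← seq_add, sub_add_cancel]

/-- The semi-inner product. In the convention of Mathlib it is conjugate linear in the first
variable: `inner ℂ x y = ∑_{t ∈ I} R(x)*(t) W(t) R(y)(t)`. -/
noncomputable instance : Inner ℂ w.SemiL2 := ⟨fun x y => ∑' t, w.form x.seq y.seq t⟩

theorem hasSum_inner (x y : w.SemiL2) :
    HasSum (fun t => w.form x.seq y.seq t) (inner ℂ (toLp x) (toLp y)) := by
  simp only [form_eq_inner]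
  exact lp.hasSum_inner (toLp x) (toLp y)

theorem inner_eq (x y : w.SemiL2) : inner ℂ x y = inner ℂ (toLp x) (toLp y) :=
  (hasSum_inner x y).tsum_eq

/-- The laws of a semi-inner product. -/
@[reducible]
noncomputable def core (w : Weight I n) : PreInnerProductSpace.Core ℂ w.SemiL2 where
  inner := inner ℂ
  conj_inner_symm x y := by
    rw [inner_eq, inner_eq]
    exact inner_conj_symm _ _
  re_inner_nonneg x := by
    rw [inner_eq]
    exact inner_self_nonneg
  add_left x y z := by
    rw [inner_eq, inner_eq, inner_eq, ← inner_add_left]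
    congr 1
    ext1
    exact funext (w.rep_add x.seq y.seq)
  smul_left x y c := by
    rw [inner_eq, inner_eq, ← inner_smul_left]
    congr 1
    ext1
    exact funext (w.rep_smul c x.seq)

noncomputable instance : SeminormedAddCommGroup w.SemiL2 :=
  @InnerProductSpace.Core.toSeminormedAddCommGroup ℂ w.SemiL2 _ _ _ (core w)

noncomputable instance : InnerProductSpace ℂ w.SemiL2 :=
  InnerProductSpace.ofCore (core w)

theorem inner_def (x y : w.SemiL2) : inner ℂ x y = ∑' t, w.form x.seq y.seq t := rfl

theorem norm_eq_norm_toLp (y : w.SemiL2) : ‖y‖ = ‖toLp y‖ := by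
  have h : ‖y‖ ^ 2 = ‖toLp y‖ ^ 2 := by
    rw [@norm_sq_eq_re_inner ℂ, @norm_sq_eq_re_inner ℂ _ _ _ _ (toLp y), ← inner_eq]
  exact (pow_left_inj₀ (norm_nonneg _) (norm_nonneg _) two_ne_zero).1 h

theorem isometry_toLp : Isometry (toLp (w := w)) :=
  Isometry.of_dist_eq fun x y => by
    rw [dist_eq_norm, dist_eq_norm, ← toLp_sub, norm_eq_norm_toLp]

/-- Every family of vectors on the interval is of the form `R(y)`. -/
theorem exists_shift_eq (x : I.Pt → Vec n) : ∃ y : Seq I n, ∀ t, shift y t = x t := by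
  classical
  refine ⟨fun s => Sum.elim
    (fun j => if h : ∃ t : I.Pt, t.next = s then x h.choose (Sum.inl j) else 0)
    (fun j => if h : ∃ t : I.Pt, t.toExt = s then x h.choose (Sum.inr j) else 0), fun t => ?_⟩
  ext (j | j)
  · have h : ∃ t' : I.Pt, t'.next = t.next := ⟨t, rfl⟩
    have e : h.choose = t := by
      have := congrArg Subtype.val h.choose_spec
      exact Subtype.ext (by simpa [IntInterval.Pt.next] using this)
    simp only [shift, Sum.elim_inl, dif_pos h, e]
  · have h : ∃ t' : I.Pt, t'.toExt = t.toExt := ⟨t, rfl⟩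
    have e : h.choose = t := by
      have := congrArg Subtype.val h.choose_spec
      exact Subtype.ext this
    simp only [shift, Sum.elim_inr, dif_pos h, e]

theorem range_toLp : Set.range (toLp (w := w)) =
    {f | ∀ t, f t ∈ LinearMap.range (Matrix.toEuclideanLin (w.factor t))} := by
  ext f
  constructor
  · rintro ⟨y, rfl⟩ t
    exact ⟨WithLp.toLp 2 (shift y.seq t), rfl⟩
  · intro hf
    choose x hx using hf
    obtain ⟨y, hy⟩ := exists_shift_eq (fun t => WithLp.ofLp (x t))
    have e : w.rep y = f := by
      funext t
      rw [← hx t, rep, hy t]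
      rfl
    exact ⟨⟨y, (w.isSqSummable_iff y).2 (e ▸ lp.memℓp f)⟩, by ext1; exact e⟩

instance : CompleteSpace w.SemiL2 := by
  rw [completeSpace_iff_isComplete_range isometry_toLp.isUniformInducing, range_toLp]
  refine IsClosed.isComplete ?_
  rw [Set.ofPred_forall]
  refine isClosed_iInter fun t => ?_
  refine IsClosed.preimage ?_ (Submodule.closed_of_finiteDimensional
    (LinearMap.range (Matrix.toEuclideanLin (w.factor t))))
  exact (lp.lipschitzWith_one_eval
    (E := fun _ : I.Pt => EuclideanSpace ℂ (Fin n ⊕ Fin n)) 2 t).continuous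

end SemiL2

/-- The Hilbert space `L²_W(I)`: the quotient of `l²_W(I)` by `{y | ‖y‖ = 0}`. -/
noncomputable abbrev L2 : Type := SeparationQuotient w.SemiL2

end Weight

/-- The class `[y]` in `L²_W(I)` of an element `y` of `l²_W(I)`. -/
noncomputable abbrev cls {w : Weight I n} (y : w.SemiL2) : w.L2 := SeparationQuotient.mk y

/-- Two square summable sequences have the same class if and only if their difference has norm
zero; hence `W(t) R(g)(t)` depends on the class of `g` only. -/
theorem cls_eq_iff {w : Weight I n} (x y : w.SemiL2) : cls x = cls y ↔ ‖x - y‖ = 0 := by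
  rw [SeparationQuotient.mk_eq_mk, Metric.inseparable_iff, dist_eq_norm]

theorem mulVec_shift_eq_of_cls_eq {w : Weight I n} {g h : w.SemiL2} (e : cls g = cls h)
    (t : I.Pt) : w.mat t *ᵥ shift g.seq t = w.mat t *ᵥ shift h.seq t := by
  rw [cls_eq_iff, Weight.SemiL2.norm_eq_norm_toLp, norm_eq_zero, Weight.SemiL2.toLp_sub,
    sub_eq_zero] at e
  have h1 : w.rep g.seq t = w.rep h.seq t := congrArg (fun f => f.1 t) e
  have h2 : w.factor t *ᵥ shift g.seq t = w.factor t *ᵥ shift h.seq t :=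
    congrArg WithLp.ofLp h1
  rw [(w.exists_factor t).choose_spec, ← Matrix.mulVec_mulVec, ← Matrix.mulVec_mulVec]
  exact congrArg _ h2

variable (w : Weight I n) (P : I.Pt → Mat n)

/-- The maximal relation of the expression with coefficient `P`: the pairs `([y], [g])` such that
some `y ∈ [y]` satisfies `J Δy(t) - P(t) R(y)(t) = W(t) R(g)(t)` for all `t` in the interval. -/
noncomputable def maxRel : Submodule ℂ (w.L2 × w.L2) where
  carrier := {p | ∃ y g : w.SemiL2, cls y = p.1 ∧ cls g = p.2 ∧
    ∀ t, hamExpr P y.seq t = w.mat t *ᵥ shift g.seq t}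
  zero_mem' := ⟨0, 0, rfl, rfl, fun t => by
    simp [Weight.SemiL2.seq_zero, hamExpr_zero, shift_zero]⟩
  add_mem' := by
    rintro ⟨_, _⟩ ⟨_, _⟩ ⟨y, g, rfl, rfl, h⟩ ⟨z, k, rfl, rfl, h'⟩
    refine ⟨y + z, g + k, rfl, rfl, fun t => ?_⟩
    rw [Weight.SemiL2.seq_add, Weight.SemiL2.seq_add, hamExpr_add, shift_add, Matrix.mulVec_add,
      h, h']
  smul_mem' := by
    rintro c ⟨_, _⟩ ⟨y, g, rfl, rfl, h⟩
    refine ⟨c • y, c • g, rfl, rfl, fun t => ?_⟩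
    rw [Weight.SemiL2.seq_smul, Weight.SemiL2.seq_smul, hamExpr_smul, shift_smul,
      Matrix.mulVec_smul, h]

/-- `y(t) = 0` for `t ≤ s` and for `t ≥ k + 1`, for some points `s`, `k` of the interval. -/
def HasFiniteSupport (y : Seq I n) : Prop :=
  ∃ s k : I.Pt, ∀ t : I.ExtPt, (t.1 ≤ s.1 ∨ k.1 + 1 ≤ t.1) → y t = 0

theorem HasFiniteSupport.add {x y : Seq I n} (hx : HasFiniteSupport x)
    (hy : HasFiniteSupport y) : HasFiniteSupport (x + y) := by
  obtain ⟨s, k, h⟩ := hx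
  obtain ⟨s', k', h'⟩ := hy
  obtain ⟨s'', hs⟩ : ∃ r : I.Pt, r.1 ≤ s.1 ∧ r.1 ≤ s'.1 := by
    rcases le_total s.1 s'.1 with e | e
    exacts [⟨s, le_rfl, e⟩, ⟨s', e, le_rfl⟩]
  obtain ⟨k'', hk⟩ : ∃ r : I.Pt, k.1 ≤ r.1 ∧ k'.1 ≤ r.1 := by
    rcases le_total k.1 k'.1 with e | e
    exacts [⟨k', e, le_rfl⟩, ⟨k, le_rfl, e⟩]
  refine ⟨s'', k'', fun t ht => ?_⟩
  rw [Pi.add_apply, h t (by omega), h' t (by omega), add_zero]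

/-- The pre-minimal relation: the pairs `([y], [g])` such that some finitely supported `y ∈ [y]`
satisfies `J Δy(t) - P(t) R(y)(t) = W(t) R(g)(t)` for all `t` in the interval. -/
noncomputable def preMinRel : Submodule ℂ (w.L2 × w.L2) where
  carrier := {p | ∃ y g : w.SemiL2, cls y = p.1 ∧ cls g = p.2 ∧ HasFiniteSupport y.seq ∧
    ∀ t, hamExpr P y.seq t = w.mat t *ᵥ shift g.seq t}
  zero_mem' := by
    obtain ⟨t₀⟩ := I.nonempty_pt
    exact ⟨0, 0, rfl, rfl, ⟨t₀, t₀, fun _ _ => rfl⟩, fun t => by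
      simp [Weight.SemiL2.seq_zero, hamExpr_zero, shift_zero]⟩
  add_mem' := by
    rintro ⟨_, _⟩ ⟨_, _⟩ ⟨y, g, rfl, rfl, hy, h⟩ ⟨z, k, rfl, rfl, hz, h'⟩
    refine ⟨y + z, g + k, rfl, rfl, hy.add hz, fun t => ?_⟩
    rw [Weight.SemiL2.seq_add, Weight.SemiL2.seq_add, hamExpr_add, shift_add, Matrix.mulVec_add,
      h, h']
  smul_mem' := by
    rintro c ⟨_, _⟩ ⟨y, g, rfl, rfl, ⟨s, k, hy⟩, h⟩
    refine ⟨c • y, c • g, rfl, rfl, ⟨s, k, fun t ht => ?_⟩, fun t => ?_⟩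
    · rw [Weight.SemiL2.seq_smul, Pi.smul_apply, hy t ht, smul_zero]
    · rw [Weight.SemiL2.seq_smul, Weight.SemiL2.seq_smul, hamExpr_smul, shift_smul,
        Matrix.mulVec_smul, h]

/-- The minimal relation: the closure of the pre-minimal relation in `L²_W(I) × L²_W(I)`. -/
noncomputable def minRel : Submodule ℂ (w.L2 × w.L2) := (preMinRel w P).topologicalClosure

/-- Closed linear relations `T`, `S` in a Hilbert space `X` form a dual pair if
`⟨f, y⟩ = ⟨x, g⟩` for all `(x, f) ∈ T` and `(y, g) ∈ S`. -/
def IsDualPair {X : Type*} [NormedAddCommGroup X] [InnerProductSpace ℂ X] [CompleteSpace X]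
    (T S : Submodule ℂ (X × X)) : Prop :=
  IsClosed (T : Set (X × X)) ∧ IsClosed (S : Set (X × X)) ∧
    ∀ x f y g : X, (x, f) ∈ T → (y, g) ∈ S → inner ℂ f y = inner ℂ x g

end DiscreteHamiltonian

namespace DiscreteHamiltonian

open scoped Matrix ComplexOrder

/-! Invertibility of `1 - A` and `1 - D` makes the coefficients of `y(t+1)` and `y(t)` invertible.
The equation is thus solvable in both directions from any value at one point, the solution is
unique, and its kernel has dimension `2n` (`exists_hamExpr_eq`, `eq_of_hamLin_eq`). Summation by
parts (`lagrange_identity`) moves the expression of `P` onto that of `P*` up to boundary terms.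
These vanish against finitely supported `y`, so the maximal relation of `P*` lies in the adjoint of
the pre-minimal relation, which is also the adjoint of its closure.

For the converse, let `(z, h)` be in the adjoint and let `x` be any solution, square summable or
not, of the `P*`-equation with right-hand side `W R(h)`. By Green's formula `z - x` pairs to zero
with every finitely supported `g` for which `W g` is reached from a finitely supported `y`. All `g`
orthogonal to the kernel of the `P*`-expression are of this kind (`exists_hasFiniteSupport`). That
kernel is finite dimensional, so linear algebra alone gives a kernel element `φ` with `W R(z - x -
φ) = 0`. Hence `x + φ` solves the equation and represents `[z]`. No definiteness condition is
needed, since everything is compared only after applying `W`. -/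

theorem exists_int_seq {α : Type*} (r : ℤ → α → α → Prop) (hf : ∀ m x, ∃ y, r m x y)
    (hb : ∀ m y, ∃ x, r m x y) (s : ℤ) (x₀ : α) :
    ∃ y : ℤ → α, y s = x₀ ∧ ∀ m, r m (y m) (y (m + 1)) := by
  choose F hF using hf
  choose G hG using hb
  let up : ℕ → α := fun k => Nat.rec x₀ (fun j x => F (s + j) x) k
  let down : ℕ → α := fun k => Nat.rec x₀ (fun j x => G (s - j - 1) x) k
  have hup : ∀ j, up (j + 1) = F (s + j) (up j) := fun _ => rfl
  have hdown : ∀ j, down (j + 1) = G (s - j - 1) (down j) := fun _ => rfl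
  refine ⟨fun m => if s ≤ m then up (m - s).toNat else down (s - m).toNat, by simp [up], ?_⟩
  intro m
  beta_reduce
  rcases le_or_gt s m with h | h
  · obtain ⟨j, rfl⟩ := Int.le.dest h
    have e : (s + j + 1 - s).toNat = j + 1 := by omega
    have e' : (s + j - s).toNat = j := by omega
    rw [if_pos h, if_pos (by omega), e, e', hup]
    exact hF _ _
  · obtain ⟨j, hj⟩ := Int.le.dest (Int.add_one_le_iff.2 h)
    obtain rfl : m = s - j - 1 := by omega
    have e : (s - (s - (j : ℤ) - 1)).toNat = j + 1 := by omega
    rw [if_neg (by omega), e, hdown]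
    rcases Nat.eq_zero_or_pos j with rfl | hj'
    -- The two branches meet here: `m + 1 = s`, and `up 0` and `down 0` are both `x₀`.
    · rw [if_pos (by simp)]
      have : (s - ((0 : ℕ) : ℤ) - 1 + 1 - s).toNat = 0 := by simp
      rw [this]
      exact hG _ _
    · rw [if_neg (by omega)]
      have : (s - (s - (j : ℤ) - 1 + 1)).toNat = j := by omega
      rw [this]
      exact hG _ _

/-! ### Invertibility of the recursion coefficients -/

section Coefficients

variable {n : ℕ}

/-- The coefficient of `y(t+1)` in `J Δy(t) - P(t) R(y)(t)`. -/
noncomputable def nextCoeff (P : Mat n) : Mat n :=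
  Matrix.J (Fin n) ℂ - P * Matrix.fromBlocks 1 0 0 0

/-- The coefficient of `y(t)` in `J Δy(t) - P(t) R(y)(t)`. -/
noncomputable def currCoeff (P : Mat n) : Mat n :=
  -Matrix.J (Fin n) ℂ - P * Matrix.fromBlocks 0 0 0 1

/-- Invertibility of `1 - A` and `1 - D` for `P = [[-C, D], [A, B]]`. -/
def IsRegular (P : Mat n) : Prop :=
  IsUnit (1 - P.toBlocks₂₁) ∧ IsUnit (1 - P.toBlocks₁₂)

/-- Conjugate transposition exchanges the positions of `A` and `D`, so the condition is symmetric
only because it involves both. -/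
theorem IsRegular.conjTranspose {P : Mat n} (h : IsRegular P) : IsRegular Pᴴ := by
  have e₁ : 1 - Pᴴ.toBlocks₂₁ = (1 - P.toBlocks₁₂)ᴴ := by
    rw [Matrix.conjTranspose_sub, Matrix.conjTranspose_one]; rfl
  have e₂ : 1 - Pᴴ.toBlocks₁₂ = (1 - P.toBlocks₂₁)ᴴ := by
    rw [Matrix.conjTranspose_sub, Matrix.conjTranspose_one]; rfl
  exact ⟨e₁ ▸ h.2.star, e₂ ▸ h.1.star⟩

/-- The matrix is `[[C, -1], [1 - A, 0]]`, whose antidiagonal blocks are invertible. For square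
matrices a right inverse suffices. -/
theorem IsRegular.isUnit_nextCoeff {P : Mat n} (h : IsRegular P) : IsUnit (nextCoeff P) := by
  obtain ⟨X, hX⟩ := h.1.exists_right_inv
  rw [← Matrix.fromBlocks_toBlocks P]
  refine (IsUnit.of_mul_eq_one (Matrix.fromBlocks 0 X (-1) (-P.toBlocks₁₁ * X)) ?_)
  rw [nextCoeff, Matrix.J, Matrix.fromBlocks_multiply, sub_eq_add_neg,
    Matrix.fromBlocks_neg, Matrix.fromBlocks_add,
    Matrix.fromBlocks_multiply, ← Matrix.fromBlocks_one]
  congr 1 <;> simp [← sub_eq_add_neg, hX]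

/-- Here the matrix is `[[0, 1 - D], [-1, -B]]`. -/
theorem IsRegular.isUnit_currCoeff {P : Mat n} (h : IsRegular P) : IsUnit (currCoeff P) := by
  obtain ⟨X, hX⟩ := h.2.exists_right_inv
  rw [← Matrix.fromBlocks_toBlocks P]
  refine (IsUnit.of_mul_eq_one (Matrix.fromBlocks (-P.toBlocks₂₂ * X) (-1) X 0) ?_)
  rw [currCoeff, Matrix.J, Matrix.fromBlocks_multiply, Matrix.fromBlocks_neg,
    sub_eq_add_neg, Matrix.fromBlocks_neg, Matrix.fromBlocks_add, Matrix.fromBlocks_multiply, ← Matrix.fromBlocks_one]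
  congr 1 <;> simp [← sub_eq_add_neg, hX]

end Coefficients

/-! ### The initial value problem -/

variable {I : IntInterval} {n : ℕ}

theorem hamExpr_eq (P : I.Pt → Mat n) (y : Seq I n) (t : I.Pt) :
    hamExpr P y t = nextCoeff (P t) *ᵥ y t.next + currCoeff (P t) *ᵥ y t.toExt := by
  have h : shift y t = Matrix.fromBlocks 1 0 0 0 *ᵥ y t.next
      + Matrix.fromBlocks 0 0 0 1 *ᵥ y t.toExt := by
    ext (j | j) <;> simp [shift, Matrix.fromBlocks_mulVec]
  rw [hamExpr, h, nextCoeff, currCoeff, Matrix.mulVec_sub, Matrix.mulVec_add, Matrix.sub_mulVec,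
    Matrix.sub_mulVec, Matrix.neg_mulVec, Matrix.mulVec_mulVec, Matrix.mulVec_mulVec]
  abel

theorem exists_pt {m : ℤ} {t s : I.ExtPt} (h₁ : t.1 = m) (h₂ : s.1 = m + 1) :
    ∃ p : I.Pt, p.toExt = t ∧ p.next = s := by
  refine ⟨⟨m, h₁ ▸ t.2.1, ?_⟩, Subtype.ext h₁.symm, Subtype.ext h₂.symm⟩
  have h := s.2.2
  rw [h₂] at h
  cases hb : I.b with
  | top => exact le_top
  | coe b =>
    rw [hb] at h
    have h' : m + 1 ≤ b + 1 := by exact_mod_cast h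
    exact WithTop.coe_le_coe.2 (by omega)

/-- Existence of a solution with a prescribed value at one point. -/
theorem exists_hamExpr_eq {P : I.Pt → Mat n} (hP : ∀ t, IsRegular (P t)) (f : I.Pt → Vec n)
    (s : I.ExtPt) (x₀ : Vec n) : ∃ y : Seq I n, y s = x₀ ∧ ∀ t, hamExpr P y t = f t := by
  obtain ⟨y, h₀, hy⟩ := exists_int_seq
    -- The recursion runs over all of `ℤ`. The relation is vacuous when `m` is not in the interval,
    -- so the filler value `0` is harmless and the endpoints need no special treatment.
    (fun m x x' => ∀ t : I.Pt, t.1 = m →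
      nextCoeff (P t) *ᵥ x' + currCoeff (P t) *ᵥ x = f t)
    (fun m x => by
      by_cases h : ∃ t : I.Pt, t.1 = m
      · obtain ⟨t, rfl⟩ := h
        obtain ⟨x', hx'⟩ := Matrix.mulVec_surjective_iff_isUnit.2 (hP t).isUnit_nextCoeff
          (f t - currCoeff (P t) *ᵥ x)
        refine ⟨x', fun t' ht' => ?_⟩
        obtain rfl : t' = t := Subtype.ext ht'
        rw [hx', sub_add_cancel]
      · exact ⟨0, fun t ht => absurd ⟨t, ht⟩ h⟩)
    (fun m x' => by
      by_cases h : ∃ t : I.Pt, t.1 = m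
      · obtain ⟨t, rfl⟩ := h
        obtain ⟨x, hx⟩ := Matrix.mulVec_surjective_iff_isUnit.2 (hP t).isUnit_currCoeff
          (f t - nextCoeff (P t) *ᵥ x')
        refine ⟨x, fun t' ht' => ?_⟩
        obtain rfl : t' = t := Subtype.ext ht'
        rw [hx, add_sub_cancel]
      · exact ⟨0, fun t ht => absurd ⟨t, ht⟩ h⟩) s.1 x₀
  refine ⟨fun t => y t.1, h₀, fun t => ?_⟩
  rw [hamExpr_eq]
  exact hy t.1 t rfl

/-- A solution that vanishes at `s` vanishes to the right of `s` if the right-hand side does. -/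
theorem eq_zero_of_le {P : I.Pt → Mat n} (hP : ∀ t, IsRegular (P t)) {y : Seq I n} {s : I.ExtPt}
    (hs : y s = 0) (hy : ∀ t : I.Pt, s.1 ≤ t.1 → hamExpr P y t = 0) (t : I.ExtPt)
    (ht : s.1 ≤ t.1) : y t = 0 := by
  suffices h : ∀ m : ℤ, s.1 ≤ m → ∀ t : I.ExtPt, t.1 = m → y t = 0 from h t.1 ht t rfl
  intro m hm
  induction m, hm using Int.leInduction with
  | base => exact fun t ht => by rwa [show t = s from Subtype.ext ht]
  | succ m hm ih =>
    intro t ht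
    have hmem : I.a ≤ (m : WithBot ℤ) ∧ (m : WithTop ℤ) ≤ I.b + 1 :=
      ⟨s.2.1.trans (WithBot.coe_le_coe.2 hm),
        (WithTop.coe_le_coe.2 (by omega : m ≤ t.1)).trans t.2.2⟩
    obtain ⟨p, hp, rfl⟩ := exists_pt (t := ⟨m, hmem⟩) rfl ht
    have hpm : p.1 = m := congrArg Subtype.val hp
    have h := hy p (by omega)
    rw [hamExpr_eq, hp, ih ⟨m, hmem⟩ rfl, Matrix.mulVec_zero, add_zero] at h
    exact Matrix.mulVec_injective_of_isUnit (hP p).isUnit_nextCoeff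
      (h.trans (Matrix.mulVec_zero _).symm)

/-- A solution that vanishes at `s` vanishes to the left of `s` if the right-hand side does. -/
theorem eq_zero_of_ge {P : I.Pt → Mat n} (hP : ∀ t, IsRegular (P t)) {y : Seq I n} {s : I.ExtPt}
    (hs : y s = 0) (hy : ∀ t : I.Pt, t.1 < s.1 → hamExpr P y t = 0) (t : I.ExtPt)
    (ht : t.1 ≤ s.1) : y t = 0 := by
  suffices h : ∀ m : ℤ, m ≤ s.1 → ∀ t : I.ExtPt, t.1 = m → y t = 0 from h t.1 ht t rfl
  intro m hm
  induction m, hm using Int.leInductionDown with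
  | base => exact fun t ht => by rwa [show t = s from Subtype.ext ht]
  | pred m hm ih =>
    intro t ht
    have hmem : I.a ≤ (m : WithBot ℤ) ∧ (m : WithTop ℤ) ≤ I.b + 1 :=
      ⟨t.2.1.trans (WithBot.coe_le_coe.2 (by omega)),
        (WithTop.coe_le_coe.2 hm).trans s.2.2⟩
    obtain ⟨p, rfl, hp⟩ := exists_pt (s := ⟨m, hmem⟩) ht (by simp)
    have hpm : p.1 + 1 = m := congrArg Subtype.val hp
    have h := hy p (by omega)
    rw [hamExpr_eq, hp, ih ⟨m, hmem⟩ rfl, Matrix.mulVec_zero, zero_add] at h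
    exact Matrix.mulVec_injective_of_isUnit (hP p).isUnit_currCoeff
      (h.trans (Matrix.mulVec_zero _).symm)

/-- The expression `J Δy - P R(y)` as a linear map. -/
noncomputable def hamLin (P : I.Pt → Mat n) : Seq I n →ₗ[ℂ] (I.Pt → Vec n) where
  toFun := hamExpr P
  map_add' x y := funext (hamExpr_add P x y)
  map_smul' c y := funext (hamExpr_smul P c y)

/-- The partial right shift as a linear map. -/
def shiftLin : Seq I n →ₗ[ℂ] (I.Pt → Vec n) where
  toFun := shift
  map_add' x y := funext (shift_add x y)
  map_smul' c y := funext (shift_smul c y)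

/-- Solutions of the same equation that agree at one point are equal. -/
theorem eq_of_hamLin_eq {P : I.Pt → Mat n} (hP : ∀ t, IsRegular (P t)) {x y : Seq I n}
    (h : hamLin P x = hamLin P y) (s : I.ExtPt) (hs : x s = y s) : x = y := by
  have h₀ : ∀ t, hamExpr P (x - y) t = 0 := fun t => by
    have : hamLin P (x - y) = 0 := by rw [map_sub, h, sub_self]
    exact congrFun this t
  have hs₀ : (x - y) s = 0 := by rw [Pi.sub_apply, hs, sub_self]
  refine sub_eq_zero.1 (funext fun t => ?_)
  rcases le_total s.1 t.1 with e | e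
  · exact eq_zero_of_le hP hs₀ (fun t _ => h₀ t) t e
  · exact eq_zero_of_ge hP hs₀ (fun t _ => h₀ t) t e

/-! ### Summation by parts and Green's formula -/

/-- The points between `s` and `k`. -/
noncomputable def window (s k : I.Pt) : Finset I.Pt :=
  open scoped Classical in
  (Finset.Icc s.1 k.1).subtype (fun t : ℤ => I.a ≤ (t : WithBot ℤ) ∧ (t : WithTop ℤ) ≤ I.b)

theorem mem_window {s k t : I.Pt} : t ∈ window s k ↔ s.1 ≤ t.1 ∧ t.1 ≤ k.1 := by
  classical
  exact Finset.mem_subtype.trans Finset.mem_Icc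

theorem sum_window_sub {s k : I.Pt} (hsk : s.1 ≤ k.1) (β : I.ExtPt → ℂ) :
    ∑ t ∈ window s k, (β t.next - β t.toExt) = β k.next - β s.toExt := by
  suffices h : ∀ m : ℤ, s.1 ≤ m → ∀ k : I.Pt, k.1 = m →
      ∑ t ∈ window s k, (β t.next - β t.toExt) = β k.next - β s.toExt from h k.1 hsk k rfl
  intro m hm
  induction m, hm using Int.leInduction with
  | base =>
    intro k hk
    obtain rfl : k = s := Subtype.ext hk
    have : window k k = {k} := by
      ext t
      rw [mem_window, Finset.mem_singleton]
      exact ⟨fun h => Subtype.ext (le_antisymm h.2 h.1), fun h => h ▸ ⟨le_rfl, le_rfl⟩⟩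
    rw [this, Finset.sum_singleton]
  | succ m hm ih =>
    intro k hk
    classical
    let p : I.Pt := ⟨m, s.2.1.trans (WithBot.coe_le_coe.2 hm),
      (WithTop.coe_le_coe.2 (by omega : m ≤ k.1)).trans k.2.2⟩
    have hp : p.next = k.toExt := Subtype.ext hk.symm
    have : window s k = insert k (window s p) := by
      ext t
      rw [Finset.mem_insert, mem_window, mem_window]
      constructor
      · rintro ⟨h₁, h₂⟩
        by_cases e : t.1 = k.1
        · exact Or.inl (Subtype.ext e)
        · exact Or.inr ⟨h₁, show t.1 ≤ m by omega⟩
      · rintro (rfl | ⟨h₁, h₂⟩)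
        · exact ⟨by omega, le_rfl⟩
        · exact ⟨h₁, le_trans h₂ (show m ≤ k.1 by omega)⟩
    rw [this, Finset.sum_insert (fun h => ?_), ih p rfl, hp]
    · ring
    · have : k.1 ≤ m := (mem_window.1 h).2
      omega

/-- The form `star x ⬝ᵥ J y`, up to sign. -/
def bracket (x y : Vec n) : ℂ :=
  star (fun j => x (Sum.inr j)) ⬝ᵥ (fun j => y (Sum.inl j))
    - star (fun j => x (Sum.inl j)) ⬝ᵥ (fun j => y (Sum.inr j))

/-- The bracket is nondegenerate: a unit vector in one component reads off a coordinate of the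
other. -/
theorem eq_zero_of_bracket {y : Vec n} (h : ∀ x, bracket x y = 0) : y = 0 := by
  ext (j | j)
  · simpa [bracket, dotProduct, Pi.single_apply, apply_ite] using
      h (Sum.elim 0 (Pi.single j 1))
  · simpa [bracket, dotProduct, Pi.single_apply, apply_ite] using
      h (Sum.elim (Pi.single j 1) 0)

/-- The shift takes `u` at `t + 1` and `v` at `t`. With this choice the mixed terms in `u(t+1)` and
`v(t)` cancel and an exact difference remains. -/
theorem lagrange_identity (P : I.Pt → Mat n) (x y : Seq I n) (t : I.Pt) :
    star (shift x t) ⬝ᵥ hamExpr P y t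
        - star (hamExpr (fun t => (P t)ᴴ) x t) ⬝ᵥ shift y t =
      bracket (x t.next) (y t.next) - bracket (x t.toExt) (y t.toExt) := by
  have h : star ((P t)ᴴ *ᵥ shift x t) ⬝ᵥ shift y t = star (shift x t) ⬝ᵥ (P t *ᵥ shift y t) := by
    rw [Matrix.star_mulVec, Matrix.conjTranspose_conjTranspose, Matrix.dotProduct_mulVec]
  simp only [hamExpr, star_sub, sub_dotProduct, dotProduct_sub, h]
  -- The two terms containing `P` are equal by `h` and drop out.
  rw [sub_sub_sub_cancel_right]
  simp only [Matrix.J, Matrix.fromBlocks_mulVec, shift, bracket, dotProduct,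
    Fintype.sum_sum_type, ← Finset.sum_sub_distrib, ← Finset.sum_add_distrib]
  refine Finset.sum_congr rfl fun j _ => ?_
  simp [Matrix.neg_mulVec]
  ring

theorem sum_window_lagrange (P : I.Pt → Mat n) (x y : Seq I n) {s k : I.Pt} (hsk : s.1 ≤ k.1) :
    ∑ t ∈ window s k, star (shift x t) ⬝ᵥ hamExpr P y t
        - ∑ t ∈ window s k, star (hamExpr (fun t => (P t)ᴴ) x t) ⬝ᵥ shift y t =
      bracket (x k.next) (y k.next) - bracket (x s.toExt) (y s.toExt) := by
  rw [← Finset.sum_sub_distrib, ← sum_window_sub hsk fun t => bracket (x t) (y t)]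
  exact Finset.sum_congr rfl fun t _ => lagrange_identity P x y t

theorem HasFiniteSupport.exists_le {y : Seq I n} (hy : HasFiniteSupport y) :
    ∃ s k : I.Pt, s.1 ≤ k.1 ∧ ∀ t : I.ExtPt, (t.1 ≤ s.1 ∨ k.1 + 1 ≤ t.1) → y t = 0 := by
  obtain ⟨s, k, h⟩ := hy
  rcases le_total s.1 k.1 with e | e
  · exact ⟨s, k, e, h⟩
  -- If `k ≤ s`, the two ranges cover everything, so `y = 0` and any window will do.
  · exact ⟨s, s, le_rfl, fun t ht => h t (by omega)⟩

/-- Off the window `t` and `t + 1` lie on the same side. When `t + 1 = s` this uses that `y`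
vanishes at `s` itself. -/
theorem eq_zero_of_notMem_window {y : Seq I n} {s k : I.Pt}
    (h : ∀ t : I.ExtPt, (t.1 ≤ s.1 ∨ k.1 + 1 ≤ t.1) → y t = 0) {t : I.Pt}
    (ht : t ∉ window s k) : y t.next = 0 ∧ y t.toExt = 0 := by
  rw [mem_window] at ht
  have e₁ : t.next.1 = t.1 + 1 := rfl
  have e₂ : t.toExt.1 = t.1 := rfl
  exact ⟨h _ (by omega), h _ (by omega)⟩

theorem shift_eq_zero {y : Seq I n} {t : I.Pt} (h : y t.next = 0 ∧ y t.toExt = 0) :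
    shift y t = 0 := by
  ext (j | j) <;> simp [shift, h.1, h.2]

theorem hamExpr_eq_zero (P : I.Pt → Mat n) {y : Seq I n} {t : I.Pt}
    (h : y t.next = 0 ∧ y t.toExt = 0) : hamExpr P y t = 0 := by
  rw [hamExpr_eq, h.1, h.2, Matrix.mulVec_zero, Matrix.mulVec_zero, add_zero]

/-- Green's formula for a finitely supported sequence. -/
theorem HasFiniteSupport.tsum_green (P : I.Pt → Mat n) (x : Seq I n) {y : Seq I n}
    (hy : HasFiniteSupport y) :
    ∑' t, star (shift x t) ⬝ᵥ hamExpr P y t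
      = ∑' t, star (hamExpr (fun t => (P t)ᴴ) x t) ⬝ᵥ shift y t := by
  obtain ⟨s, k, hsk, h⟩ := hy.exists_le
  -- Both series are finite sums over the window, so nothing is required of `x` at infinity. The
  -- boundary terms contain `y(k+1) = 0` and `y(s) = 0`.
  rw [tsum_eq_sum (s := window s k), tsum_eq_sum (s := window s k), ← sub_eq_zero,
    sum_window_lagrange P x y hsk, h _ (Or.inr (le_refl (k.1 + 1))), h _ (Or.inl (le_refl s.1))]
  · simp [bracket]
  · intro t ht
    rw [shift_eq_zero (eq_zero_of_notMem_window h ht), dotProduct_zero]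
  · intro t ht
    rw [hamExpr_eq_zero P (eq_zero_of_notMem_window h ht), dotProduct_zero]

/-! ### Finitely supported solutions -/

theorem exists_window (K : Finset I.Pt) :
    ∃ s k : I.Pt, s.1 ≤ k.1 ∧ K ⊆ window s k := by
  classical
  induction K using Finset.induction_on with
  | empty =>
    obtain ⟨t⟩ := I.nonempty_pt
    exact ⟨t, t, le_rfl, Finset.empty_subset _⟩
  | insert t K _ ih =>
    obtain ⟨s, k, hsk, hK⟩ := ih
    obtain ⟨s', hs⟩ : ∃ r : I.Pt, r.1 ≤ s.1 ∧ r.1 ≤ t.1 := by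
      rcases le_total s.1 t.1 with e | e
      exacts [⟨s, le_rfl, e⟩, ⟨t, e, le_rfl⟩]
    obtain ⟨k', hk⟩ : ∃ r : I.Pt, k.1 ≤ r.1 ∧ t.1 ≤ r.1 := by
      rcases le_total k.1 t.1 with e | e
      exacts [⟨t, e, le_rfl⟩, ⟨k, le_rfl, e⟩]
    refine ⟨s', k', by omega, Finset.insert_subset (mem_window.2 ⟨hs.2, hk.2⟩) fun r hr => ?_⟩
    have := mem_window.1 (hK hr)
    exact mem_window.2 ⟨by omega, by omega⟩

/-- A finitely supported right-hand side that is orthogonal to the kernel of the adjoint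
expression admits a finitely supported solution. -/
theorem exists_hasFiniteSupport {P : I.Pt → Mat n} (hP : ∀ t, IsRegular (P t))
    (f : I.Pt → Vec n) (K : Finset I.Pt) (hK : ∀ t ∉ K, f t = 0)
    (hf : ∀ φ : Seq I n, hamLin (fun t => (P t)ᴴ) φ = 0 →
      ∑ t ∈ K, star (shift φ t) ⬝ᵥ f t = 0) :
    ∃ y : Seq I n, HasFiniteSupport y ∧ ∀ t, hamExpr P y t = f t := by
  obtain ⟨s, k, hsk, hw⟩ := exists_window K
  obtain ⟨y, hys, hy⟩ := exists_hamExpr_eq hP f s.toExt 0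
  have hf₀ : ∀ t : I.Pt, (t.1 < s.1 ∨ k.1 < t.1) → hamExpr P y t = 0 := fun t ht => by
    rw [hy, hK]
    intro h
    have := mem_window.1 (hw h)
    omega
  -- The solution started from `0` at `s` must return to `0` at `k + 1`. A kernel element `φ` can
  -- have any value `x` at `k + 1`, and the Lagrange sum identifies the bracket of `x` and `y(k+1)`
  -- with the pairing of `φ` and `f`, which is zero.
  have hyk : y k.next = 0 := by
    refine eq_zero_of_bracket fun x => ?_
    obtain ⟨φ, hφk, hφ⟩ := exists_hamExpr_eq (fun t => (hP t).conjTranspose) 0 k.next x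
    have h := sum_window_lagrange P φ y hsk
    have h₁ : ∑ t ∈ window s k, star (shift φ t) ⬝ᵥ hamExpr P y t = 0 := by
      rw [← hf φ (funext hφ), ← Finset.sum_subset hw fun t _ ht => by
        rw [hy, hK t ht, dotProduct_zero]]
      exact Finset.sum_congr rfl fun t _ => by rw [hy]
    have h₂ : ∑ t ∈ window s k, star (hamExpr (fun t => (P t)ᴴ) φ t) ⬝ᵥ shift y t = 0 :=
      Finset.sum_eq_zero fun t _ => by rw [hφ]; simp
    rw [h₁, h₂, hφk, hys] at h
    simpa [bracket] using h.symm
  refine ⟨y, ⟨s, k, fun t ht => ?_⟩, hy⟩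
  -- Outside the window the right-hand side vanishes, so the zeros at `s` and `k + 1` propagate
  -- outwards.
  rcases ht with ht | ht
  · exact eq_zero_of_ge hP hys (fun t h => hf₀ t (Or.inl h)) t ht
  · refine eq_zero_of_le hP hyk (fun t h => hf₀ t (Or.inr ?_)) t ht
    exact Int.lt_of_add_one_le h

/-! ### The weighted pairing with finitely supported families -/

namespace Weight

variable (w : Weight I n)

theorem isHermitian_mat (t : I.Pt) : (w.mat t)ᴴ = w.mat t := by
  rw [mat, Matrix.fromBlocks_conjTranspose, (w.posSemidef₁ t).1, (w.posSemidef₂ t).1]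
  simp

theorem star_mulVec_mat (t : I.Pt) (p q : Vec n) :
    star (w.mat t *ᵥ p) ⬝ᵥ q = star p ⬝ᵥ (w.mat t *ᵥ q) := by
  rw [Matrix.star_mulVec, isHermitian_mat, Matrix.dotProduct_mulVec]

/-- The functional `g ↦ ∑ t, q(t)* W(t) g(t)` on finitely supported families. -/
noncomputable def pairing (q : I.Pt → Vec n) : (I.Pt →₀ Vec n) →ₗ[ℂ] ℂ :=
  Finsupp.lsum ℂ fun t =>
    { toFun := fun v => star (q t) ⬝ᵥ (w.mat t *ᵥ v)
      map_add' := fun u v => by rw [Matrix.mulVec_add, dotProduct_add]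
      map_smul' := fun c v => by rw [Matrix.mulVec_smul, dotProduct_smul, RingHom.id_apply] }

theorem pairing_apply (q : I.Pt → Vec n) (g : I.Pt →₀ Vec n) :
    w.pairing q g = ∑ t ∈ g.support, star (q t) ⬝ᵥ (w.mat t *ᵥ g t) := rfl

theorem pairing_eq_tsum (q : I.Pt → Vec n) (g : I.Pt →₀ Vec n) :
    w.pairing q g = ∑' t, star (q t) ⬝ᵥ (w.mat t *ᵥ g t) := by
  rw [pairing_apply, tsum_eq_sum]
  intro t ht
  rw [Finsupp.notMem_support_iff.1 ht, Matrix.mulVec_zero, dotProduct_zero]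

theorem pairing_add (p q : I.Pt → Vec n) : w.pairing (p + q) = w.pairing p + w.pairing q := by
  ext g
  simp [pairing, add_dotProduct]

theorem pairing_smul (c : ℂ) (q : I.Pt → Vec n) :
    w.pairing (c • q) = star c • w.pairing q := by
  ext g
  simp [pairing, smul_dotProduct]

/-- The functional `w.pairing q` is conjugate linear in `q`. -/
noncomputable def pairingLin :
    (I.Pt → Vec n) →ₛₗ[starRingEnd ℂ] ((I.Pt →₀ Vec n) →ₗ[ℂ] ℂ) where
  toFun := w.pairing
  map_add' := w.pairing_add
  map_smul' := w.pairing_smul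

theorem mat_mulVec_eq_zero_of_pairing {q : I.Pt → Vec n} (h : w.pairing q = 0) (t : I.Pt) :
    w.mat t *ᵥ q t = 0 := by
  have h₁ : ∀ v, star (w.mat t *ᵥ q t) ⬝ᵥ v = 0 := fun v => by
    have := LinearMap.congr_fun h (Finsupp.single t v)
    rwa [pairing, Finsupp.lsum_single, LinearMap.coe_mk, AddHom.coe_mk, LinearMap.zero_apply,
      ← star_mulVec_mat] at this
  -- Testing against `W(t) q(t)` itself gives its squared norm.
  exact dotProduct_star_self_eq_zero.1 (by
    rw [← h₁ (w.mat t *ᵥ q t), dotProduct_comm])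

theorem isSqSummable_of_finite {y : Seq I n} (K : Finset I.Pt)
    (h : ∀ t ∉ K, shift y t = 0) : w.IsSqSummable y := by
  refine summable_of_ne_finset_zero (s := K) fun t ht => ?_
  simp [form, h t ht]

/-- As `W` is Hermitian, the form depends only on `W R(x)`. This makes the corrected solution square
summable although its two summands need not be. -/
theorem isSqSummable_of_mat_mulVec_eq {x y : Seq I n} (hx : w.IsSqSummable x)
    (h : ∀ t, w.mat t *ᵥ shift x t = w.mat t *ᵥ shift y t) : w.IsSqSummable y := by
  refine hx.congr fun t => ?_
  rw [form, form, h, ← star_mulVec_mat, h, star_mulVec_mat]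

end Weight

/-! ### From orthogonality to a solution in the class -/

theorem cls_eq_of_mat_mulVec_eq {w : Weight I n} {x y : w.SemiL2}
    (h : ∀ t, w.mat t *ᵥ shift x.seq t = w.mat t *ᵥ shift y.seq t) : cls x = cls y := by
  rw [cls_eq_iff, ← sq_eq_zero_iff, @norm_sq_eq_re_inner ℂ, Weight.SemiL2.inner_def]
  have h₀ : ∀ t, w.form (x - y).seq (x - y).seq t = 0 := fun t => by
    have e : shift (x - y).seq t = shift x.seq t - shift y.seq t :=
      congrFun (map_sub shiftLin x.seq y.seq) t
    rw [Weight.form, e, Matrix.mulVec_sub, h, sub_self, dotProduct_zero]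
  simp [h₀]

variable (w : Weight I n)

theorem inner_eq_of_maxRel (P : I.Pt → Mat n) {y g z h : w.SemiL2}
    (hy : HasFiniteSupport y.seq) (hyg : ∀ t, hamExpr P y.seq t = w.mat t *ᵥ shift g.seq t)
    (hzh : ∀ t, hamExpr (fun t => (P t)ᴴ) z.seq t = w.mat t *ᵥ shift h.seq t) :
    inner ℂ z g = inner ℂ h y := by
  have e := hy.tsum_green P z.seq
  simp only [hyg, hzh, Weight.star_mulVec_mat] at e
  exact e

/-- The kernel of the expression is spanned by the solutions with unit vectors as values at `s`. -/
theorem eq_sum_smul_of_hamLin_eq_zero {P : I.Pt → Mat n} (hP : ∀ t, IsRegular (P t))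
    (s : I.ExtPt) {Φ : Fin n ⊕ Fin n → Seq I n} (hΦ : ∀ i, hamLin P (Φ i) = 0)
    (hs : ∀ i, Φ i s = Pi.single i 1) {φ : Seq I n} (hφ : hamLin P φ = 0) :
    φ = ∑ i, φ s i • Φ i := by
  refine eq_of_hamLin_eq hP ?_ s ?_
  · simp [hφ, hΦ]
  · ext j
    simp [Finset.sum_apply, hs, Pi.single_apply]

/-- The hard inclusion, stated for sequences. A particular solution is corrected by a kernel element
so that it agrees with `z` after multiplication by `W`. -/
theorem exists_solution_of_inner_eq {P : I.Pt → Mat n} (hP : ∀ t, IsRegular (P t))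
    (z h : w.SemiL2)
    (H : ∀ y g : w.SemiL2, HasFiniteSupport y.seq →
      (∀ t, hamExpr P y.seq t = w.mat t *ᵥ shift g.seq t) → inner ℂ z g = inner ℂ h y) :
    ∃ x : Seq I n, (∀ t, hamExpr (fun t => (P t)ᴴ) x t = w.mat t *ᵥ shift h.seq t) ∧
      ∀ t, w.mat t *ᵥ shift z.seq t = w.mat t *ᵥ shift x t := by
  have hP' : ∀ t, IsRegular (P t)ᴴ := fun t => (hP t).conjTranspose
  obtain ⟨t₀⟩ := I.nonempty_pt
  obtain ⟨x, -, hx⟩ := exists_hamExpr_eq hP' (fun t => w.mat t *ᵥ shift h.seq t) t₀.toExt 0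
  choose Φ hΦs hΦ using fun i : Fin n ⊕ Fin n =>
    exists_hamExpr_eq hP' 0 t₀.toExt (Pi.single i 1)
  have hΦ' : ∀ i, hamLin (fun t => (P t)ᴴ) (Φ i) = 0 := fun i => funext (hΦ i)
  have key : w.pairingLin (shiftLin (z.seq - x)) ∈
      Submodule.span ℂ (Set.range fun i => w.pairingLin (shiftLin (Φ i))) := by
    -- A functional vanishing on the common kernel of finitely many functionals lies in their span.
    -- It remains to treat `g` orthogonal to every `Φ i`.
    refine mem_span_of_iInf_ker_le_ker fun g hg => ?_
    rw [Submodule.mem_iInf] at hg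
    obtain ⟨y, hy, hyg⟩ := exists_hasFiniteSupport hP (fun t => w.mat t *ᵥ g t) g.support
      (fun t ht => by rw [Finsupp.notMem_support_iff.1 ht, Matrix.mulVec_zero])
      (fun φ hφ => by
        change w.pairingLin (shiftLin φ) g = 0
        rw [eq_sum_smul_of_hamLin_eq_zero hP' t₀.toExt hΦ' hΦs hφ]
        simp only [map_sum, map_smulₛₗ, LinearMap.sum_apply, LinearMap.smul_apply]
        exact Finset.sum_eq_zero fun i _ => by
          rw [show w.pairingLin (shiftLin (Φ i)) g = 0 from hg i, smul_zero])
    obtain ⟨g', hg'⟩ := Weight.SemiL2.exists_shift_eq g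
    have hg's : w.IsSqSummable g' := w.isSqSummable_of_finite g.support fun t ht => by
      rw [hg', Finsupp.notMem_support_iff.1 ht]
    have hys : w.IsSqSummable y := by
      obtain ⟨s, k, -, hsk⟩ := hy.exists_le
      exact w.isSqSummable_of_finite (window s k) fun t ht =>
        shift_eq_zero (eq_zero_of_notMem_window hsk ht)
    have e₁ : ∑' t, w.form z.seq g' t = ∑' t, w.form h.seq y t :=
      H ⟨y, hys⟩ ⟨g', hg's⟩ hy fun t => by
        change hamExpr P y t = w.mat t *ᵥ shift g' t
        rw [hyg, hg']
    have e₂ := hy.tsum_green P x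
    simp only [hyg, hx, Weight.star_mulVec_mat] at e₂
    simp only [Weight.form, hg'] at e₁
    -- By `e₁` and `e₂`, the pairings of `z` and of `x` with `g` both equal the pairing of `h` with
    -- `y`.
    rw [LinearMap.mem_ker, map_sub, map_sub, LinearMap.sub_apply, sub_eq_zero]
    exact (w.pairing_eq_tsum _ g).trans ((e₁.trans e₂.symm).trans (w.pairing_eq_tsum _ g).symm)
  obtain ⟨c, hc⟩ := (Submodule.mem_span_range_iff_exists_fun ℂ).1 key
  -- The coefficients are conjugated because the pairing is conjugate linear in its sequence.
  obtain ⟨φ, hφ⟩ : ∃ φ : Seq I n, φ = ∑ i, star (c i) • Φ i := ⟨_, rfl⟩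
  have hφ₀ : hamLin (fun t => (P t)ᴴ) φ = 0 := by simp [hφ, hΦ']
  have hφc : w.pairingLin (shiftLin φ) = ∑ i, c i • w.pairingLin (shiftLin (Φ i)) := by
    simp [hφ, map_smulₛₗ]
  have h₀ : w.pairingLin (shiftLin (z.seq - x - φ)) = 0 := by
    rw [map_sub, map_sub, hφc, hc, sub_self]
  refine ⟨x + φ, fun t => ?_, fun t => ?_⟩
  · have e : hamExpr (fun t => (P t)ᴴ) φ t = 0 := congrFun hφ₀ t
    rw [hamExpr_add, hx, e, add_zero]
  · have e := w.mat_mulVec_eq_zero_of_pairing h₀ t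
    rw [sub_sub, map_sub, Pi.sub_apply, Matrix.mulVec_sub] at e
    exact sub_eq_zero.1 e

/-! ### Adjoints and closures of linear relations -/

section Relations

variable {X : Type*} [NormedAddCommGroup X] [InnerProductSpace ℂ X]

theorem isClosed_adjoint (T : Submodule ℂ (X × X)) : IsClosed (T.adjoint : Set (X × X)) := by
  have : (T.adjoint : Set (X × X)) =
      ⋂ p ∈ T, {q : X × X | inner ℂ p.2 q.1 - inner ℂ p.1 q.2 = 0} := by
    ext q
    simp only [SetLike.mem_coe, Submodule.mem_adjoint_iff, Set.mem_iInter, Prod.forall]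
    rfl
  rw [this]
  exact isClosed_biInter fun p _ => isClosed_eq (by fun_prop) continuous_const

/-- For fixed `q`, the adjointness condition on `p` is closed by continuity of the inner product, so
it passes from `T` to its closure. -/
theorem adjoint_topologicalClosure (T : Submodule ℂ (X × X)) :
    T.topologicalClosure.adjoint = T.adjoint := by
  refine le_antisymm (fun q hq => ?_) (fun q hq => ?_)
  · rw [Submodule.mem_adjoint_iff] at hq ⊢
    exact fun a b hab => hq a b (T.le_topologicalClosure hab)
  · rw [Submodule.mem_adjoint_iff] at hq ⊢
    intro a b hab
    have hc : IsClosed {p : X × X | inner ℂ p.2 q.1 - inner ℂ p.1 q.2 = 0} :=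
      isClosed_eq (by fun_prop) continuous_const
    exact closure_minimal (fun p hp => hq p.1 p.2 hp) hc hab

end Relations

/-! ### The adjoint identities and the dual pair -/

theorem preMinRel_le_maxRel (P : I.Pt → Mat n) : preMinRel w P ≤ maxRel w P := by
  rintro _ ⟨y, g, hy, hg, -, h⟩
  exact ⟨y, g, hy, hg, h⟩

/-- The maximal relation of the adjoint expression is the adjoint of the minimal relation. -/
theorem maxRel_conjTranspose {P : I.Pt → Mat n} (hP : ∀ t, IsRegular (P t)) :
    maxRel w (fun t => (P t)ᴴ) = (minRel w P).adjoint := by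
  rw [minRel, adjoint_topologicalClosure]
  refine le_antisymm ?_ ?_
  · rintro ⟨_, _⟩ ⟨z, h, rfl, rfl, hzh⟩
    rw [Submodule.mem_adjoint_iff]
    rintro _ _ ⟨y, g, rfl, rfl, hy, hyg⟩
    have e := inner_eq_of_maxRel w P hy hyg hzh
    rw [SeparationQuotient.inner_mk_mk, SeparationQuotient.inner_mk_mk, sub_eq_zero,
      ← inner_conj_symm, e, inner_conj_symm]
  · rintro ⟨z, h⟩ hzh
    obtain ⟨z, rfl⟩ := SeparationQuotient.surjective_mk z
    obtain ⟨h, rfl⟩ := SeparationQuotient.surjective_mk h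
    rw [Submodule.mem_adjoint_iff] at hzh
    obtain ⟨x, hx, hzx⟩ := exists_solution_of_inner_eq w hP z h fun y g hy hyg => by
      have e := hzh (cls y) (cls g) ⟨y, g, rfl, rfl, hy, hyg⟩
      rw [SeparationQuotient.inner_mk_mk, SeparationQuotient.inner_mk_mk, sub_eq_zero] at e
      rw [← inner_conj_symm, e, inner_conj_symm]
    -- The representative of `[z]` is changed to `x`, since `z` itself need not solve the equation.
    exact ⟨⟨x, w.isSqSummable_of_mat_mulVec_eq z.2 hzx⟩, h,
      (cls_eq_of_mat_mulVec_eq hzx).symm, rfl, hx⟩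

/-- The pre-minimal relation of `P*` lies in its maximal relation, which is the adjoint of the
minimal relation of `P`. This adjoint is closed, so it also contains the minimal relation of `P*`.
-/
theorem isDualPair_minRel {P : I.Pt → Mat n} (hP : ∀ t, IsRegular (P t)) :
    IsDualPair (minRel w P) (minRel w fun t => (P t)ᴴ) := by
  refine ⟨Submodule.isClosed_topologicalClosure _, Submodule.isClosed_topologicalClosure _,
    fun x f y g hxf hyg => ?_⟩
  have h : minRel w (fun t => (P t)ᴴ) ≤ (minRel w P).adjoint :=
    Submodule.topologicalClosure_minimal _
      ((preMinRel_le_maxRel w _).trans (maxRel_conjTranspose w hP).le) (isClosed_adjoint _)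
  exact sub_eq_zero.1 ((Submodule.mem_adjoint_iff _ _).1 (h hyg) x f hxf)

end DiscreteHamiltonian

theorem mainTheorem3 (n : ℕ) (I : DiscreteHamiltonian.IntInterval)
    (w : DiscreteHamiltonian.Weight I n) (A B C D : I.Pt → Matrix (Fin n) (Fin n) ℂ)
    (P : I.Pt → DiscreteHamiltonian.Mat n)
    (hP : ∀ t, P t = Matrix.fromBlocks (-C t) (D t) (A t) (B t))
    (hA : ∀ t, IsUnit (1 - A t)) (hD : ∀ t, IsUnit (1 - D t)) :
    DiscreteHamiltonian.maxRel w (fun t => (P t).conjTranspose) =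
        (DiscreteHamiltonian.minRel w P).adjoint ∧
      DiscreteHamiltonian.maxRel w P =
        (DiscreteHamiltonian.minRel w (fun t => (P t).conjTranspose)).adjoint ∧
      DiscreteHamiltonian.IsDualPair (DiscreteHamiltonian.minRel w P)
        (DiscreteHamiltonian.minRel w (fun t => (P t).conjTranspose)) := by
  have hreg : ∀ t, DiscreteHamiltonian.IsRegular (P t) := fun t => by
    rw [hP t]
    exact ⟨hA t, hD t⟩
  refine ⟨DiscreteHamiltonian.maxRel_conjTranspose w hreg, ?_,
    DiscreteHamiltonian.isDualPair_minRel w hreg⟩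
  -- The second identity is the first one for `P*`, as `P** = P`.
  have h := DiscreteHamiltonian.maxRel_conjTranspose w fun t => (hreg t).conjTranspose
  simpa only [Matrix.conjTranspose_conjTranspose] using h
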